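/- Let $n\ge 2$ be even. The planar $n$-complex numbers are $u=x_0+h_1x_1+\cdots+h_{n-1}x_{n-1}$ with real $x_j$, with the modulus $|u|=(x_0^2+\cdots+x_{n-1}^2)^{1/2}$ and the commutative, associative, bilinear product given by $h_0=1$ and $h_jh_k=(-1)^{[(j+k)/n]}h_{j+k-n[(j+k)/n]}$ for $0\le j,k\le n-1$, where $[x]$ denotes the integer part of $x$. For $k=1,\ldots,n/2$ put $$\tilde e_k=\frac2n\sum_{p=1}^{n-1}h_p\sin\frac{\pi(2k-1)p}{n},\qquad \xi_k=\sqrt{\tfrac2n}\sum_{p=0}^{n-1}x_p\cos\frac{\pi(2k-1)p}{n},\qquad \eta_k=\sqrt{\tfrac2n}\sum_{p=0}^{n-1}x_p\sin\frac{\pi(2k-1)p}{n},$$ and let $u_{\xi_k\eta_k}=(\xi_k,\eta_k)$ be the projection of $u$ on the $(\xi_k,\eta_k)$ plane. For a closed curve $C$ in a plane and a point $M$ of the plane not on $C$, let $\mathrm{int}(M,C)=1$ if $M$ is interior to $C$, that is, if the connected component of the complement of $C$ that contains $M$ is bounded, and $\mathrm{int}(M,C)=0$ if $M$ is exterior to $C$,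 that is, if this component is unbounded. Let $\Gamma$ be a closed piecewise $C^1$ path in the space of planar $n$-complex numbers such that, for $k=1,\ldots,n/2$, the projection $\Gamma_{\xi_k\eta_k}$ of $\Gamma$ on the $(\xi_k,\eta_k)$ plane is counterclockwise, in the sense that each bounded component of its complement contains a point around which $\Gamma_{\xi_k\eta_k}$ goes exactly once counterclockwise, i.e. the azimuthal angle about that point increases in total by $2\pi$ along the curve. (If $\Gamma_{\xi_k\eta_k}$ is a simple closed curve, this says that it is positively oriented.) Then the following integrals exist and have the values stated. 1. If $u-u_0$ is invertible for all $u\in\Gamma$, then $$\oint_\Gamma\frac{du}{u-u_0}=\sum_{k=1}^{n/2}2\pi\tilde e_k\,\mathrm{int}(u_{0\xi_k\eta_k},\Gamma_{\xi_k\eta_k}).$$ 2. If $u-u_0$ is invertible for all $u\in\Gamma$, and $f$ has an absolutely convergent expansion $f(u)=\sum_{m=0}^\infty c_m(u-u_0)^m$, with $n$-complex coefficients $c_m$, that holds at $u_0$ and at every point of $\Gamma$ (in particular, if it holds at $u_0$, on $\Gamma$ and on a surface spanning $\Gamma$), then $$\oint_\Gamma\frac{f(u)\,du}{u-u_0}=2\pi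 f(u_0)\sum_{k=1}^{n/2}\tilde e_k\,\mathrm{int}(u_{0\xi_k\eta_k},\Gamma_{\xi_k\eta_k}).$$ 3. Let $(u_l)$ be a finite or infinite family of $n$-complex numbers such that $u-u_l$ is invertible for all $l$ and all $u\in\Gamma$. For each $l$ let $F_l(u)=\sum_{m\in\mathbb Z}c_{l,m}(u-u_l)^m$ be a series in positive and negative powers, with $n$-complex coefficients, that converges absolutely at every point of $\Gamma$, and put $r_l=c_{l,-1}$. If $f=\sum_lF_l$ on $\Gamma$, where for an infinite family the (unordered) sum over $l$ converges uniformly on $\Gamma$, then $$\oint_\Gamma f(u)\,du=2\pi\sum_l\sum_{k=1}^{n/2}\tilde e_k\,\mathrm{int}(u_{l\xi_k\eta_k},\Gamma_{\xi_k\eta_k})\,r_l,$$ where for an infinite family the sum over $l$ on the right-hand side converges unconditionally. -/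

import Mathlib

/-- The planar `n`-complex numbers `u = x_0 + h_1 x_1 + ⋯ + h_{n-1} x_{n-1}` with real components,
with the Euclidean modulus `|u| = (x_0² + ⋯ + x_{n-1}²)^{1/2}`. -/
def PlanarComplex (n : ℕ) : Type := EuclideanSpace ℝ (Fin n)

namespace PlanarComplex

noncomputable instance instNormedAddCommGroup (n : ℕ) : NormedAddCommGroup (PlanarComplex n) :=
  inferInstanceAs (NormedAddCommGroup (EuclideanSpace ℝ (Fin n)))

noncomputable instance instNormedSpace (n : ℕ) : NormedSpace ℝ (PlanarComplex n) :=
  inferInstanceAs (NormedSpace ℝ (EuclideanSpace ℝ (Fin n)))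

instance instFiniteDimensional (n : ℕ) : FiniteDimensional ℝ (PlanarComplex n) :=
  inferInstanceAs (FiniteDimensional ℝ (EuclideanSpace ℝ (Fin n)))

/-- The number with components `x_0, …, x_{n-1}`. -/
def ofCoord {n : ℕ} (x : Fin n → ℝ) : PlanarComplex n := WithLp.toLp 2 x

/-- The component `x_j` of `u`. -/
def coord {n : ℕ} (u : PlanarComplex n) (j : Fin n) : ℝ := WithLp.ofLp u j

@[simp] theorem coord_ofCoord {n : ℕ} (x : Fin n → ℝ) (j : Fin n) : (ofCoord x).coord j = x j := rfl

@[simp] theorem coord_zero {n : ℕ} (j : Fin n) : (0 : PlanarComplex n).coord j = 0 := rfl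

@[simp] theorem coord_add {n : ℕ} (u v : PlanarComplex n) (j : Fin n) :
    (u + v).coord j = u.coord j + v.coord j := rfl

@[simp] theorem coord_smul {n : ℕ} (r : ℝ) (u : PlanarComplex n) (j : Fin n) :
    (r • u).coord j = r * u.coord j := rfl

theorem ext_coord {n : ℕ} {u v : PlanarComplex n} (h : ∀ j, u.coord j = v.coord j) : u = v :=
  PiLp.ext h

/-- The `k`-th component of the product `h_i h_j`, as a function of `a = i + j`:
`h_i h_j = (-1)^[a/n] h_{a - n[a/n]}`. -/
def structureConst (n a : ℕ) (k : Fin n) : ℝ := if a % n = k then (-1) ^ (a / n) else 0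

/-- The product determined by bilinearity and the rule for `h_i h_j`. -/
instance instMul (n : ℕ) : Mul (PlanarComplex n) :=
  ⟨fun u v => ofCoord fun k =>
    ∑ i : Fin n, ∑ j : Fin n, structureConst n (i + j) k * (u.coord i * v.coord j)⟩

/-- The unit `1 = h_0`. -/
instance instOne (n : ℕ) : One (PlanarComplex n) :=
  ⟨ofCoord fun j => if (j : ℕ) = 0 then 1 else 0⟩

theorem coord_mul {n : ℕ} (u v : PlanarComplex n) (k : Fin n) :
    (u * v).coord k =
      ∑ i : Fin n, ∑ j : Fin n, structureConst n (i + j) k * (u.coord i * v.coord j) := rfl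

theorem coord_one {n : ℕ} (k : Fin n) :
    (1 : PlanarComplex n).coord k = if (k : ℕ) = 0 then 1 else 0 := rfl

theorem sum_structureConst {n : ℕ} (a b : ℕ) (k : Fin n) :
    ∑ i : Fin n, structureConst n a i * structureConst n (i + b) k =
      structureConst n (a + b) k := by
  have hn : 0 < n := k.pos
  rw [Finset.sum_eq_single (⟨a % n, Nat.mod_lt _ hn⟩ : Fin n)]
  · have h1 : (a % n + b) % n = (a + b) % n := Nat.mod_add_mod a n b
    have h2 : (a + b) / n = a / n + (a % n + b) / n := by
      conv_lhs => rw [← Nat.div_add_mod a n, add_assoc, Nat.mul_add_div hn]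
    simp only [structureConst, if_true, h1, h2]
    split_ifs <;> simp [pow_add]
  · intro i _ hi
    have : ¬ a % n = i := fun h => hi (Fin.ext h.symm)
    simp [structureConst, this]
  · simp

theorem mul_comm_planar {n : ℕ} (u v : PlanarComplex n) : u * v = v * u := by
  refine ext_coord fun k => ?_
  rw [coord_mul, coord_mul, Finset.sum_comm]
  refine Finset.sum_congr rfl fun i _ => Finset.sum_congr rfl fun j _ => ?_
  rw [add_comm, mul_comm (u.coord j)]

theorem coord_mul_mul {n : ℕ} (u v w : PlanarComplex n) (k : Fin n) :
    (u * v * w).coord k = ∑ p : Fin n, ∑ q : Fin n, ∑ r : Fin n,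
      structureConst n (p + q + r) k * (u.coord p * v.coord q * w.coord r) := by
  have h : ∀ p q r : Fin n, structureConst n (p + q + r) k =
      ∑ i : Fin n, structureConst n (p + q) i * structureConst n (i + r) k := fun p q r =>
    (sum_structureConst _ _ _).symm
  simp_rw [h, coord_mul, Finset.sum_mul, Finset.mul_sum]
  rw [Finset.sum_comm]
  have : ∀ r : Fin n,
      ∑ i : Fin n, ∑ p : Fin n, ∑ q : Fin n, structureConst n (i + r) k *
        (structureConst n (p + q) i * (u.coord p * v.coord q) * w.coord r) =
      ∑ p : Fin n, ∑ q : Fin n, ∑ i : Fin n, structureConst n (p + q) i *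
        structureConst n (i + r) k * (u.coord p * v.coord q * w.coord r) := by
    intro r
    rw [Finset.sum_comm]
    refine Finset.sum_congr rfl fun p _ => ?_
    rw [Finset.sum_comm]
    refine Finset.sum_congr rfl fun q _ => Finset.sum_congr rfl fun i _ => ?_
    ring
  simp_rw [this]
  rw [Finset.sum_comm]
  refine Finset.sum_congr rfl fun p _ => ?_
  rw [Finset.sum_comm]

theorem mul_assoc_planar {n : ℕ} (u v w : PlanarComplex n) : u * v * w = u * (v * w) := by
  refine ext_coord fun k => ?_
  rw [mul_comm_planar u (v * w), coord_mul_mul, coord_mul_mul, Finset.sum_comm]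
  refine Finset.sum_congr rfl fun q _ => ?_
  rw [Finset.sum_comm]
  refine Finset.sum_congr rfl fun r _ => Finset.sum_congr rfl fun p _ => ?_
  rw [show (p : ℕ) + q + r = q + r + p by ring]
  ring

theorem one_mul_planar {n : ℕ} (u : PlanarComplex n) : 1 * u = u := by
  refine ext_coord fun k => ?_
  have hn : 0 < n := k.pos
  rw [coord_mul, Finset.sum_eq_single (⟨0, hn⟩ : Fin n), Finset.sum_eq_single k]
  · simp [coord_one, structureConst, Nat.mod_eq_of_lt k.isLt, Nat.div_eq_of_lt k.isLt]
  · intro j _ hj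
    have : ¬ (j : ℕ) = k := fun h => hj (Fin.ext h)
    simp [structureConst, Nat.mod_eq_of_lt j.isLt, this]
  · simp
  · intro i _ hi
    have : ¬ (i : ℕ) = 0 := fun h => hi (Fin.ext h)
    simp [coord_one, this]
  · simp

theorem add_mul_planar {n : ℕ} (u v w : PlanarComplex n) : (u + v) * w = u * w + v * w := by
  refine ext_coord fun k => ?_
  simp only [coord_mul, coord_add, ← Finset.sum_add_distrib]
  refine Finset.sum_congr rfl fun i _ => Finset.sum_congr rfl fun j _ => ?_
  ring

theorem smul_mul_planar {n : ℕ} (r : ℝ) (u v : PlanarComplex n) : (r • u) * v = r • (u * v) := by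
  refine ext_coord fun k => ?_
  simp only [coord_mul, coord_smul, Finset.mul_sum]
  refine Finset.sum_congr rfl fun i _ => Finset.sum_congr rfl fun j _ => ?_
  ring

theorem zero_mul_planar {n : ℕ} (u : PlanarComplex n) : 0 * u = 0 := by
  refine ext_coord fun k => ?_
  simp [coord_mul]

noncomputable instance instCommRing (n : ℕ) : CommRing (PlanarComplex n) :=
  { instNormedAddCommGroup n, instMul n, instOne n with
    mul_assoc := mul_assoc_planar
    mul_comm := mul_comm_planar
    one_mul := one_mul_planar
    mul_one := fun u => by rw [mul_comm_planar, one_mul_planar]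
    zero_mul := zero_mul_planar
    mul_zero := fun u => by rw [mul_comm_planar, zero_mul_planar]
    right_distrib := add_mul_planar
    left_distrib := fun u v w => by
      rw [mul_comm_planar, add_mul_planar, mul_comm_planar v, mul_comm_planar w] }

noncomputable instance instAlgebra (n : ℕ) : Algebra ℝ (PlanarComplex n) :=
  Algebra.ofModule smul_mul_planar fun r u v => by
    rw [mul_comm_planar, smul_mul_planar, mul_comm_planar]

/-- The element `ẽ_k = (2/n) ∑_p h_p sin (π (2k-1) p / n)` of the canonical basis,
`k = 1, …, n/2`. -/
noncomputable def eTilde (n k : ℕ) : PlanarComplex n :=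
  ofCoord fun p => 2 / (n : ℝ) * Real.sin (Real.pi * (2 * (k : ℝ) - 1) * (p : ℕ) / n)

/-- The rotated coordinate `ξ_k` of `u`, `k = 1, …, n/2`. -/
noncomputable def xi {n : ℕ} (k : ℕ) (u : PlanarComplex n) : ℝ :=
  ∑ p : Fin n, Real.sqrt (2 / n) * Real.cos (Real.pi * (2 * (k : ℝ) - 1) * (p : ℕ) / n) * u.coord p

/-- The rotated coordinate `η_k` of `u`, `k = 1, …, n/2`. -/
noncomputable def eta {n : ℕ} (k : ℕ) (u : PlanarComplex n) : ℝ :=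
  ∑ p : Fin n, Real.sqrt (2 / n) * Real.sin (Real.pi * (2 * (k : ℝ) - 1) * (p : ℕ) / n) * u.coord p

/-- The projection of `u` on the `(ξ_k, η_k)` plane, this plane being identified with `ℂ` through
`ξ_k + i η_k`. -/
noncomputable def proj {n : ℕ} (k : ℕ) (u : PlanarComplex n) : ℂ := ⟨xi k u, eta k u⟩

/-- `z` is an interior point of the closed plane curve with trace `C`: it is not on the curve, and
the connected component of the complement of the curve that contains `z` is bounded.
(The points that are neither on `C` nor interior are the exterior ones.) -/
def IsInteriorPoint (z : ℂ) (C : Set ℂ) : Prop :=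
  z ∉ C ∧ Bornology.IsBounded (connectedComponentIn Cᶜ z)

open Classical in
/-- The functional `int(z, C)`: `1` if `z` is an interior point of `C`, and `0` if it is exterior. -/
noncomputable def interiorIndicator (z : ℂ) (C : Set ℂ) : ℝ := if IsInteriorPoint z C then 1 else 0

/-- Along `c`, the azimuthal angle about `z` increases in total by `2π`: `c` goes around `z` exactly
once, counterclockwise. -/
def WindsOnceAround (c : unitInterval → ℂ) (z : ℂ) : Prop :=
  ∃ φ : C(unitInterval, ℝ),
    (∀ t, c t - z = (‖c t - z‖ : ℂ) * Complex.exp ((φ t : ℂ) * Complex.I)) ∧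
      φ 1 - φ 0 = 2 * Real.pi

/-- A closed plane curve is counterclockwise if, in each bounded component of its complement, there
is a point around which it goes exactly once, counterclockwise. For a simple closed curve, which
has exactly one such component, this is positive orientation; a curve without interior points
(a constant one, or a segment that is run through to and fro) is included. -/
def IsCounterclockwise (c : unitInterval → ℂ) : Prop :=
  ∀ z, IsInteriorPoint z (Set.range c) →
    ∃ w ∈ connectedComponentIn (Set.range c)ᶜ z, WindsOnceAround c w

/-- The projection of the loop `Γ` on the `(ξ_k, η_k)` plane, with its parametrization. -/
noncomputable def projLoop {n : ℕ} {a : PlanarComplex n} (k : ℕ) (Γ : Path a a) :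
    unitInterval → ℂ := fun t => proj k (Γ t)

/-- `int(u_{0 ξ_k η_k}, Γ_{ξ_k η_k})`. -/
noncomputable def intProj {n : ℕ} {a : PlanarComplex n} (k : ℕ) (u₀ : PlanarComplex n)
    (Γ : Path a a) : ℝ := interiorIndicator (proj k u₀) (Set.range (projLoop k Γ))

/-- The loop is continuous, and continuously differentiable on each of the closed pieces of some
finite partition of `[0, 1]`. -/
def IsPiecewiseC1 {n : ℕ} {a : PlanarComplex n} (Γ : Path a a) : Prop :=
  ∃ (N : ℕ) (t : ℕ → ℝ), Monotone t ∧ t 0 = 0 ∧ t N = 1 ∧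
    ∀ i < N, ContDiffOn ℝ 1 Γ.extend (Set.Icc (t i) (t (i + 1)))

/-- The form `f(u) du`, that is `v ↦ f(u) v` at the point `u`. -/
noncomputable def form {n : ℕ} (f : PlanarComplex n → PlanarComplex n) :
    PlanarComplex n → PlanarComplex n →L[ℝ] PlanarComplex n :=
  fun u => LinearMap.toContinuousLinearMap (LinearMap.mulLeft ℝ (f u))

/-- `f(u) du` is integrable along `Γ`, and `∮_Γ f(u) du = I`. -/
def HasLoopIntegral {n : ℕ} {a : PlanarComplex n} (f : PlanarComplex n → PlanarComplex n)
    (Γ : Path a a) (I : PlanarComplex n) : Prop :=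
  CurveIntegrable (form f) Γ ∧ curveIntegral (form f) Γ = I

/-- Integer powers of an invertible `w`. -/
noncomputable def intPow {n : ℕ} (w : PlanarComplex n) : ℤ → PlanarComplex n
  | Int.ofNat m => w ^ m
  | Int.negSucc m => Ring.inverse w ^ (m + 1)

end PlanarComplex

/-! Since `h_1 ^ n = -1`, the algebra is `ℝ[X]/(X^n + 1)`. For even `n` the roots of `-1` are the
non-real numbers `ω_k = exp(iπ(2k-1)/n)` and their conjugates, `k = 1, …, n/2`, so the characters
`h_p ↦ ω_k ^ p` split the algebra into `n/2` copies of `ℂ`. The projection on the `(ξ_k, η_k)` plane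
is the `k`-th character times `√(2/n)` (`proj_eq`), and `ẽ_k` is `i` in the `k`-th copy and `0` in
the others (`char_eTilde`). As these characters separate points (`eq_zero_of_char_eq_zero`), every
formula can be checked in each of them, where it becomes a statement about a complex line integral.

There, a Laurent series that converges on the curve is integrated term by term, and only the power
`-1` has no single-valued primitive (`integral_laurent`). What remains is `∮ dw/(w - z)`. It takes
values in `2πiℤ` and is continuous in `z` off the curve, hence constant on each component of the
complement. It vanishes on an unbounded component, by its smallness far away, and equals `2πi` on a
bounded one, because it does so at the point that the orientation hypothesis provides
(`cauchyIntegral_eq_interiorIndicator`). Invertibility of `u - u₀` on `Γ` makes every projected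
curve avoid the projection of `u₀`. -/

section

/-! ### The integral of `dw / (w - z)` along a plane loop -/

open MeasureTheory Set Filter Topology

/-- A closed curve `γ` on `[0, 1]` that is, off a countable set, differentiable with continuous
derivative `γ'`, where `γ'` is integrable. -/
structure IsPiecewiseLoop (γ γ' : ℝ → ℂ) : Prop where
  closed : γ 0 = γ 1
  continuousOn : ContinuousOn γ (Icc 0 1)
  integrable : IntervalIntegrable γ' volume 0 1
  exists_hasDerivAt : ∃ S : Set ℝ, S.Countable ∧
    ∀ t ∈ Ioo (0 : ℝ) 1 \ S, HasDerivAt γ (γ' t) t ∧ ContinuousAt γ' t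

/-- The integral of `dw / (w - z)` along a plane curve. -/
noncomputable def cauchyIntegral (γ γ' : ℝ → ℂ) (z : ℂ) : ℂ :=
  ∫ t in (0 : ℝ)..1, γ' t / (γ t - z)

/-- A continuous function with values in the discrete set `2πiℤ` is constant on a connected set. It
is applied along the parameter of a curve, to compare two logarithms, and along a component of the
complement, to move `z`. -/
theorem IsPreconnected.eq_of_exp_eq_one {X : Type*} [TopologicalSpace X] {S : Set X}
    (hS : IsPreconnected S) {f : X → ℂ} (hf : ContinuousOn f S)
    (h : ∀ x ∈ S, Complex.exp (f x) = 1) {x y : X} (hx : x ∈ S) (hy : y ∈ S) : f x = f y := by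
  have hd : DiscreteTopology (range ((↑) : ℤ → ℝ)) :=
    (Int.isClosedEmbedding_coe_real.isEmbedding.toHomeomorph.symm).isEmbedding.discreteTopology
  have hint : ∀ x ∈ S, ∃ n : ℤ, f x = n * (2 * Real.pi * Complex.I) := fun x hx =>
    Complex.exp_eq_one_iff.1 (h x hx)
  have him : ∀ x ∈ S, ∀ n : ℤ, f x = n * (2 * Real.pi * Complex.I) →
      (f x).im / (2 * Real.pi) = n := by
    intro x _ n hn
    rw [hn]
    have : (((n : ℂ) * (2 * Real.pi * Complex.I)).im) = n * (2 * Real.pi) := by simp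
    rw [this, mul_div_assoc, div_self Real.two_pi_pos.ne', mul_one]
  have hmaps : MapsTo (fun x => (f x).im / (2 * Real.pi)) S (range ((↑) : ℤ → ℝ)) := by
    intro x hx
    obtain ⟨n, hn⟩ := hint x hx
    exact ⟨n, (him x hx n hn).symm⟩
  have hc : ContinuousOn (fun x => (f x).im / (2 * Real.pi)) S :=
    (Complex.continuous_im.comp_continuousOn hf).div_const _
  have key := hS.constant_of_mapsTo ⟨hd⟩ hc hmaps hx hy
  obtain ⟨n, hn⟩ := hint x hx
  obtain ⟨m, hm⟩ := hint y hy
  simp only [him x hx n hn, him y hy m hm] at key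
  rw [hn, hm, Int.cast_inj.1 key]

namespace IsPiecewiseLoop

variable {γ γ' : ℝ → ℂ}

theorem exists_le_norm_sub (h : IsPiecewiseLoop γ γ') {z : ℂ}
    (hz : ∀ t ∈ Icc (0 : ℝ) 1, γ t ≠ z) : ∃ d > 0, ∀ t ∈ Icc (0 : ℝ) 1, d ≤ ‖γ t - z‖ := by
  obtain ⟨t₀, ht₀, hmin⟩ := isCompact_Icc.exists_isMinOn (nonempty_Icc.2 zero_le_one)
    (f := fun t => ‖γ t - z‖) (h.continuousOn.sub continuousOn_const).norm
  exact ⟨‖γ t₀ - z‖, norm_pos_iff.2 (sub_ne_zero.2 (hz t₀ ht₀)), fun t ht => hmin ht⟩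

theorem intervalIntegrable_mul (h : IsPiecewiseLoop γ γ') {G : ℝ → ℂ}
    (hG : ContinuousOn G (Icc 0 1)) : IntervalIntegrable (fun t => G t * γ' t) volume 0 1 :=
  h.integrable.continuousOn_mul (by rwa [uIcc_of_le zero_le_one])

theorem continuousOn_inv_sub (h : IsPiecewiseLoop γ γ') {z : ℂ}
    (hz : ∀ t ∈ Icc (0 : ℝ) 1, γ t ≠ z) : ContinuousOn (fun t => (γ t - z)⁻¹) (Icc 0 1) :=
  (h.continuousOn.sub continuousOn_const).inv₀ fun t ht => sub_ne_zero.2 (hz t ht)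

theorem intervalIntegrable_div (h : IsPiecewiseLoop γ γ') {z : ℂ}
    (hz : ∀ t ∈ Icc (0 : ℝ) 1, γ t ≠ z) :
    IntervalIntegrable (fun t => γ' t / (γ t - z)) volume 0 1 := by
  simpa only [div_eq_inv_mul] using h.intervalIntegrable_mul (h.continuousOn_inv_sub hz)

theorem continuousOn_primitive (h : IsPiecewiseLoop γ γ') {z : ℂ}
    (hz : ∀ t ∈ Icc (0 : ℝ) 1, γ t ≠ z) :
    ContinuousOn (fun t => ∫ s in (0 : ℝ)..t, γ' s / (γ s - z)) (Icc 0 1) := by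
  have := intervalIntegral.continuousOn_primitive_interval' (h.intervalIntegrable_div hz)
    (left_mem_uIcc)
  rwa [uIcc_of_le zero_le_one] at this

/-- The exponential of the primitive of `γ' / (γ - z)`. -/
theorem exp_primitive (h : IsPiecewiseLoop γ γ') {z : ℂ}
    (hz : ∀ t ∈ Icc (0 : ℝ) 1, γ t ≠ z) {t : ℝ} (ht : t ∈ Icc (0 : ℝ) 1) :
    Complex.exp (∫ s in (0 : ℝ)..t, γ' s / (γ s - z)) = (γ t - z) / (γ 0 - z) := by
  obtain ⟨S, hS, hder⟩ := h.exists_hasDerivAt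
  have hint := h.intervalIntegrable_div hz
  set M : ℝ → ℂ := fun t => ∫ s in (0 : ℝ)..t, γ' s / (γ s - z) with hM
  -- Off the countable set `S` the product `(γ - z) exp(-M)` has derivative `0`; being continuous,
  -- it keeps its initial value `γ 0 - z`.
  have hcont : ContinuousOn (fun t => (γ t - z) * Complex.exp (-M t)) (Icc 0 1) :=
    (h.continuousOn.sub continuousOn_const).mul (h.continuousOn_primitive hz).neg.cexp
  have hd : ∀ x ∈ Ioo (0 : ℝ) t \ S,
      HasDerivAt (fun t => (γ t - z) * Complex.exp (-M t)) ((fun _ => (0 : ℂ)) x) x := by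
    intro x hx
    have hx1 : x ∈ Ioo (0 : ℝ) 1 := ⟨hx.1.1, hx.1.2.trans_le ht.2⟩
    have hxI := Ioo_subset_Icc_self hx1
    obtain ⟨h1, h2⟩ := hder x ⟨hx1, hx.2⟩
    have hne : γ x - z ≠ 0 := sub_ne_zero.2 (hz x hxI)
    have hMd : HasDerivAt M (γ' x / (γ x - z)) x := by
      refine intervalIntegral.integral_hasDerivAt_right ?_ ?_ ?_
      · refine hint.mono_set ?_
        rw [uIcc_of_le zero_le_one, uIcc_of_le hxI.1]
        exact Icc_subset_Icc_right hxI.2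
      · refine ⟨Ioo 0 1, Ioo_mem_nhds hx1.1 hx1.2, ?_⟩
        rw [intervalIntegrable_iff_integrableOn_Ioo_of_le zero_le_one] at hint
        exact hint.aestronglyMeasurable
      · exact h2.div (h1.continuousAt.sub continuousAt_const) hne
    refine ((h1.sub_const z).mul hMd.neg.cexp).congr_deriv ?_
    field_simp
    ring
  have h0 := integral_eq_of_hasDerivAt_off_countable_of_le _ _ ht.1 hS
    (hcont.mono (Icc_subset_Icc_right ht.2)) hd (by simp)
  have hM0 : M 0 = 0 := by simp [hM]
  simp only [intervalIntegral.integral_zero, hM0, neg_zero, Complex.exp_zero, mul_one] at h0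
  have hne : γ 0 - z ≠ 0 := sub_ne_zero.2 (hz 0 (by simp))
  rw [eq_div_iff hne, ← sub_eq_zero.1 h0.symm, mul_comm, mul_assoc, ← Complex.exp_add]
  simp [hM]

theorem exp_cauchyIntegral (h : IsPiecewiseLoop γ γ') {z : ℂ}
    (hz : ∀ t ∈ Icc (0 : ℝ) 1, γ t ≠ z) : Complex.exp (cauchyIntegral γ γ' z) = 1 := by
  rw [cauchyIntegral, h.exp_primitive hz (by simp), h.closed, div_self]
  exact sub_ne_zero.2 (hz 1 (by simp))

/-- Up to constants, the primitive of `γ' / (γ - z)` and `log ‖γ - z‖ + iφ` are both continuous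
logarithms of `γ - z`, so they have the same increment. On a closed curve the modulus contributes
nothing, which leaves `i (φ 1 - φ 0)`. -/
theorem cauchyIntegral_of_windsOnce (h : IsPiecewiseLoop γ γ') {z : ℂ}
    (hz : ∀ t ∈ Icc (0 : ℝ) 1, γ t ≠ z)
    (hw : PlanarComplex.WindsOnceAround (fun t => γ t) z) :
    cauchyIntegral γ γ' z = 2 * Real.pi * Complex.I := by
  obtain ⟨φ, hφ, htot⟩ := hw
  set M : ℝ → ℂ := fun t => ∫ s in (0 : ℝ)..t, γ' s / (γ s - z) with hM
  have hpos : ∀ t : unitInterval, 0 < ‖γ t - z‖ := fun t =>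
    norm_pos_iff.2 (sub_ne_zero.2 (hz t t.2))
  let D : unitInterval → ℂ := fun t =>
    M t - ((Real.log ‖γ t - z‖ : ℂ) + φ t * Complex.I)
      + ((Real.log ‖γ 0 - z‖ : ℂ) + φ 0 * Complex.I)
  have hlog : ∀ t : unitInterval,
      Complex.exp ((Real.log ‖γ t - z‖ : ℂ) + φ t * Complex.I) = γ t - z := by
    intro t
    rw [Complex.exp_add, ← Complex.ofReal_exp, Real.exp_log (hpos t)]
    exact (hφ t).symm
  have hγ : Continuous fun t : unitInterval => γ t - z :=
    (h.continuousOn.comp_continuous continuous_subtype_val fun t => t.2).sub continuous_const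
  have hD : Continuous D := by
    have h1 : Continuous fun t : unitInterval => M t :=
      (h.continuousOn_primitive hz).comp_continuous continuous_subtype_val fun t => t.2
    have h2 : Continuous fun t : unitInterval => Real.log ‖γ t - z‖ :=
      hγ.norm.log fun t => (hpos t).ne'
    exact (h1.sub ((Complex.continuous_ofReal.comp h2).add
      ((Complex.continuous_ofReal.comp φ.continuous).mul continuous_const))).add continuous_const
  have hexp : ∀ t ∈ (univ : Set unitInterval), Complex.exp (D t) = 1 := by
    intro t _
    have h0 := hlog 0
    rw [Complex.exp_add, Complex.exp_sub, hlog t, h.exp_primitive hz t.2]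
    simp only [Icc.coe_zero] at h0
    rw [h0]
    have h1 : γ t - z ≠ 0 := sub_ne_zero.2 (hz t t.2)
    have h2 : γ 0 - z ≠ 0 := sub_ne_zero.2 (hz 0 (by simp))
    field_simp
  have key := isPreconnected_univ.eq_of_exp_eq_one hD.continuousOn hexp (mem_univ 1) (mem_univ 0)
  have hM0 : M 0 = 0 := by simp [hM]
  have hM1 : M 1 = cauchyIntegral γ γ' z := rfl
  have htot' : (φ 1 : ℂ) = φ 0 + 2 * Real.pi := by
    rw [← sub_eq_iff_eq_add']; exact_mod_cast htot
  simp only [D, Icc.coe_zero, Icc.coe_one, hM0, hM1,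
    htot', h.closed] at key
  linear_combination key

/-- Dominated convergence: if the curve keeps distance `d` from `z`, it keeps distance `d / 2` from
all points of the ball of radius `d / 2` about `z`. -/
theorem continuousAt_cauchyIntegral (h : IsPiecewiseLoop γ γ') {z : ℂ}
    (hz : ∀ t ∈ Icc (0 : ℝ) 1, γ t ≠ z) : ContinuousAt (cauchyIntegral γ γ') z := by
  obtain ⟨d, hd, hle⟩ := h.exists_le_norm_sub hz
  have hball : ∀ᶠ w in 𝓝 z, dist w z < d / 2 := Metric.ball_mem_nhds z (half_pos hd)
  have hlow : ∀ w, dist w z < d / 2 → ∀ t ∈ Icc (0 : ℝ) 1, d / 2 ≤ ‖γ t - w‖ := by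
    intro w hw t ht
    have h1 := hle t ht
    have h2 : ‖γ t - z‖ ≤ ‖γ t - w‖ + ‖w - z‖ := by
      simpa using norm_add_le (γ t - w) (w - z)
    rw [dist_eq_norm] at hw
    linarith
  refine intervalIntegral.continuousAt_of_dominated_interval
    (bound := fun t => ‖γ' t‖ / (d / 2)) ?_ ?_ (h.integrable.norm.div_const _) ?_
  · filter_upwards [hball] with w hw
    refine (h.intervalIntegrable_div fun t ht he => ?_).def'.aestronglyMeasurable
    have := hlow w hw t ht
    rw [he, sub_self, norm_zero] at this
    linarith
  · filter_upwards [hball] with w hw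
    refine Eventually.of_forall fun t ht => ?_
    rw [uIoc_of_le zero_le_one] at ht
    rw [norm_div]
    exact div_le_div_of_nonneg_left (norm_nonneg _) (half_pos hd)
      (hlow w hw t (Ioc_subset_Icc_self ht))
  · refine Eventually.of_forall fun t ht => ?_
    rw [uIoc_of_le zero_le_one] at ht
    exact continuousAt_const.div (continuousAt_const.sub continuousAt_id)
      (sub_ne_zero.2 (hz t (Ioc_subset_Icc_self ht)))

theorem norm_cauchyIntegral_le (h : IsPiecewiseLoop γ γ') {z : ℂ} {d : ℝ} (hd : 0 < d)
    (hle : ∀ t ∈ Icc (0 : ℝ) 1, d ≤ ‖γ t - z‖) :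
    ‖cauchyIntegral γ γ' z‖ ≤ (∫ t in (0 : ℝ)..1, ‖γ' t‖) / d := by
  rw [cauchyIntegral, ← intervalIntegral.integral_div]
  refine intervalIntegral.norm_integral_le_of_norm_le zero_le_one
    (Eventually.of_forall fun t ht => ?_) (h.integrable.norm.div_const d)
  rw [norm_div]
  exact div_le_div_of_nonneg_left (norm_nonneg _) hd (hle t (Ioc_subset_Icc_self ht))

theorem cauchyIntegral_eq_of_mem_component (h : IsPiecewiseLoop γ γ') {z w : ℂ}
    (hz : z ∉ γ '' Icc 0 1) (hw : w ∈ connectedComponentIn (γ '' Icc 0 1)ᶜ z) :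
    cauchyIntegral γ γ' w = cauchyIntegral γ γ' z := by
  have hsub : ∀ x ∈ connectedComponentIn (γ '' Icc 0 1)ᶜ z, ∀ t ∈ Icc (0 : ℝ) 1, γ t ≠ x :=
    fun x hx t ht he => connectedComponentIn_subset _ _ hx ⟨t, ht, he⟩
  exact isPreconnected_connectedComponentIn.eq_of_exp_eq_one
    (fun x hx => (h.continuousAt_cauchyIntegral (hsub x hx)).continuousWithinAt)
    (fun x hx => h.exp_cauchyIntegral (hsub x hx)) hw (mem_connectedComponentIn hz)

/-- Far out in the component the integral has modulus less than `1`, while its nonzero possible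
values have modulus at least `2π`. -/
theorem cauchyIntegral_eq_zero_of_unbounded (h : IsPiecewiseLoop γ γ') {z : ℂ}
    (hz : z ∉ γ '' Icc 0 1)
    (hb : ¬ Bornology.IsBounded (connectedComponentIn (γ '' Icc 0 1)ᶜ z)) :
    cauchyIntegral γ γ' z = 0 := by
  obtain ⟨R, hR⟩ := isCompact_Icc.exists_bound_of_continuousOn h.continuousOn
  set K := ∫ t in (0 : ℝ)..1, ‖γ' t‖ with hK
  have hK0 : 0 ≤ K := intervalIntegral.integral_nonneg zero_le_one fun t _ => norm_nonneg _
  -- The curve lies in the disc of radius `R` and has length `K`, so at such a `w` the integral is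
  -- at most `K / (K + 1)`. The added `1` also covers a constant curve.
  obtain ⟨w, hw, hwR⟩ : ∃ w ∈ connectedComponentIn (γ '' Icc 0 1)ᶜ z, R + (K + 1) < ‖w‖ := by
    by_contra! hcon
    exact hb (isBounded_iff_forall_norm_le.2 ⟨_, hcon⟩)
  have hle : ∀ t ∈ Icc (0 : ℝ) 1, K + 1 ≤ ‖γ t - w‖ := by
    intro t ht
    have h1 := hR t ht
    have h2 := norm_sub_norm_le w (γ t)
    rw [norm_sub_rev] at h2
    linarith
  have hne : ∀ t ∈ Icc (0 : ℝ) 1, γ t ≠ w := by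
    intro t ht he
    have := hle t ht
    rw [he, sub_self, norm_zero] at this
    linarith
  rw [← h.cauchyIntegral_eq_of_mem_component hz hw]
  obtain ⟨m, hm⟩ := Complex.exp_eq_one_iff.1 (h.exp_cauchyIntegral hne)
  have hlt : ‖cauchyIntegral γ γ' w‖ < 1 :=
    (h.norm_cauchyIntegral_le (by linarith) hle).trans_lt
      ((div_lt_one (by linarith)).2 (by linarith))
  rw [hm] at hlt ⊢
  have hnorm : ‖(m : ℂ) * (2 * Real.pi * Complex.I)‖ = |(m : ℝ)| * (2 * Real.pi) := by
    simp [abs_of_pos Real.pi_pos]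
  rw [hnorm] at hlt
  by_cases hm0 : m = 0
  · simp [hm0]
  · have h1 : (1 : ℝ) ≤ |(m : ℝ)| := by exact_mod_cast Int.one_le_abs hm0
    nlinarith [Real.pi_gt_three]

/-- The integral of `dw / (w - z)` along a counterclockwise loop. -/
theorem cauchyIntegral_eq_interiorIndicator (h : IsPiecewiseLoop γ γ')
    (hc : PlanarComplex.IsCounterclockwise fun t => γ t) {z : ℂ}
    (hz : ∀ t ∈ Icc (0 : ℝ) 1, γ t ≠ z) :
    cauchyIntegral γ γ' z = 2 * Real.pi * Complex.I *
      PlanarComplex.interiorIndicator z (range fun t : unitInterval => γ t) := by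
  have hrange : (range fun t : unitInterval => γ t) = γ '' Icc 0 1 := by
    ext x
    simp [unitInterval]
  have hz' : z ∉ γ '' Icc 0 1 := fun ⟨t, ht, he⟩ => hz t ht he
  unfold PlanarComplex.IsCounterclockwise at hc
  rw [hrange] at hc ⊢
  by_cases hi : PlanarComplex.IsInteriorPoint z (γ '' Icc 0 1)
  · obtain ⟨w, hw, hwind⟩ := hc z hi
    rw [← h.cauchyIntegral_eq_of_mem_component hz' hw, h.cauchyIntegral_of_windsOnce
      (fun t ht he => connectedComponentIn_subset _ _ hw ⟨t, ht, he⟩) hwind]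
    simp [PlanarComplex.interiorIndicator, hi]
  · rw [h.cauchyIntegral_eq_zero_of_unbounded hz' fun hb => hi ⟨hz', hb⟩]
    simp [PlanarComplex.interiorIndicator, hi]

/-! ### Term-by-term integration along a plane loop -/

/-- For `m ≠ -1` the power has the single-valued primitive `(γ - z) ^ (m + 1) / (m + 1)`, with equal
values at the two ends of the loop. -/
theorem integral_zpow_mul (h : IsPiecewiseLoop γ γ') {z : ℂ}
    (hz : ∀ t ∈ Icc (0 : ℝ) 1, γ t ≠ z) {m : ℤ} (hm : m ≠ -1) :
    ∫ t in (0 : ℝ)..1, (γ t - z) ^ m * γ' t = 0 := by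
  obtain ⟨S, hS, hder⟩ := h.exists_hasDerivAt
  have hm1 : ((m + 1 : ℤ) : ℂ) ≠ 0 := by exact_mod_cast fun h0 => hm (by omega)
  have hpow : ∀ k : ℤ, ContinuousOn (fun t => (γ t - z) ^ k) (Icc 0 1) := fun k =>
    (h.continuousOn.sub continuousOn_const).zpow₀ k fun t ht => Or.inl (sub_ne_zero.2 (hz t ht))
  rw [integral_eq_of_hasDerivAt_off_countable_of_le
    (fun t => (γ t - z) ^ (m + 1) / ((m + 1 : ℤ) : ℂ)) _ zero_le_one hS
    ((hpow _).div_const _) (fun x hx => ?_) (h.intervalIntegrable_mul (hpow m))]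
  · simp [h.closed]
  · have hne : γ x - z ≠ 0 := sub_ne_zero.2 (hz x (Ioo_subset_Icc_self hx.1))
    have h1 := ((hasDerivAt_zpow (m + 1) (γ x - z) (Or.inl hne)).comp x
      ((hder x hx).1.sub_const z)).div_const ((m + 1 : ℤ) : ℂ)
    refine h1.congr_deriv ?_
    rw [add_sub_cancel_right]
    field_simp

/-- A Laurent series that converges on the loop is continuous there and is integrated term by
term. -/
theorem integral_laurent (h : IsPiecewiseLoop γ γ') {z : ℂ}
    (hz : ∀ t ∈ Icc (0 : ℝ) 1, γ t ≠ z) {b : ℤ → ℂ} {G : ℝ → ℂ}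
    (hG : ∀ t ∈ Icc (0 : ℝ) 1, HasSum (fun m : ℤ => b m * (γ t - z) ^ m) (G t)) :
    ContinuousOn G (Icc 0 1) ∧
      ∫ t in (0 : ℝ)..1, G t * γ' t = b (-1) * cauchyIntegral γ γ' z := by
  have hcn : ContinuousOn (fun t => ‖γ t - z‖) (Icc 0 1) :=
    (h.continuousOn.sub continuousOn_const).norm
  obtain ⟨t₀, ht₀, hmin⟩ := isCompact_Icc.exists_isMinOn (nonempty_Icc.2 zero_le_one) hcn
  obtain ⟨t₁, ht₁, hmax⟩ := isCompact_Icc.exists_isMaxOn (nonempty_Icc.2 zero_le_one) hcn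
  have hpos : ∀ t ∈ Icc (0 : ℝ) 1, 0 < ‖γ t - z‖ := fun t ht =>
    norm_pos_iff.2 (sub_ne_zero.2 (hz t ht))
  -- The extreme distances from `z` are attained at points `t₀`, `t₁` of the curve itself, where the
  -- series converges absolutely. Powers with `m ≥ 0` are largest at `t₁` and those with `m ≤ 0` at
  -- `t₀`, so the two values together give a summable majorant on the whole curve.
  set B : ℤ → ℝ := fun m => ‖b m * (γ t₀ - z) ^ m‖ + ‖b m * (γ t₁ - z) ^ m‖ with hB
  have hBs : Summable B := (hG t₀ ht₀).summable.norm.add (hG t₁ ht₁).summable.norm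
  have hBle : ∀ m : ℤ, ∀ t ∈ Icc (0 : ℝ) 1, ‖b m * (γ t - z) ^ m‖ ≤ B m := by
    intro m t ht
    have hmin' : ‖γ t₀ - z‖ ≤ ‖γ t - z‖ := hmin ht
    have hmax' : ‖γ t - z‖ ≤ ‖γ t₁ - z‖ := hmax ht
    simp only [hB, norm_mul, norm_zpow]
    have hb := norm_nonneg (b m)
    rcases le_total 0 m with hm | hm
    · have := zpow_le_zpow_left₀ hm (norm_nonneg _) hmax'
      have h0 : 0 ≤ ‖b m‖ * ‖γ t₀ - z‖ ^ m := by positivity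
      nlinarith [mul_le_mul_of_nonneg_left this hb]
    · have : ‖γ t - z‖ ^ m ≤ ‖γ t₀ - z‖ ^ m := by
        obtain ⟨k, rfl⟩ : ∃ k : ℕ, m = -(k : ℤ) := ⟨m.natAbs, by omega⟩
        rw [zpow_neg, zpow_neg, zpow_natCast, zpow_natCast]
        exact inv_anti₀ (pow_pos (hpos t₀ ht₀) k) (pow_le_pow_left₀ (norm_nonneg _) hmin' k)
      have h0 : 0 ≤ ‖b m‖ * ‖γ t₁ - z‖ ^ m := by positivity
      nlinarith [mul_le_mul_of_nonneg_left this hb]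
  have hpow : ∀ k : ℤ, ContinuousOn (fun t => b k * (γ t - z) ^ k) (Icc 0 1) := fun k =>
    continuousOn_const.mul ((h.continuousOn.sub continuousOn_const).zpow₀ k
      fun t ht => Or.inl (sub_ne_zero.2 (hz t ht)))
  refine ⟨(continuousOn_tsum hpow hBs hBle).congr fun t ht => (hG t ht).tsum_eq.symm, ?_⟩
  have hsum : HasSum (fun m : ℤ => ∫ t in (0 : ℝ)..1, b m * (γ t - z) ^ m * γ' t)
      (∫ t in (0 : ℝ)..1, G t * γ' t) := by
    refine intervalIntegral.hasSum_integral_of_dominated_convergence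
      (fun m t => B m * ‖γ' t‖) (fun m => ?_) (fun m => ?_) ?_ ?_ ?_
    · exact (h.intervalIntegrable_mul (hpow m)).def'.aestronglyMeasurable
    · refine Eventually.of_forall fun t ht => ?_
      rw [uIoc_of_le zero_le_one] at ht
      rw [norm_mul]
      exact mul_le_mul_of_nonneg_right (hBle m t (Ioc_subset_Icc_self ht)) (norm_nonneg _)
    · exact Eventually.of_forall fun t _ => hBs.mul_right _
    · simp only [tsum_mul_right]
      exact h.integrable.norm.const_mul _
    · refine Eventually.of_forall fun t ht => ?_
      rw [uIoc_of_le zero_le_one] at ht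
      exact (hG t (Ioc_subset_Icc_self ht)).mul_right _
  have hsingle := hasSum_single (-1 : ℤ)
    (f := fun m : ℤ => ∫ t in (0 : ℝ)..1, b m * (γ t - z) ^ m * γ' t) (fun m hm => by
      simp only [mul_assoc]
      rw [intervalIntegral.integral_const_mul, h.integral_zpow_mul hz hm, mul_zero])
  rw [hsum.unique hsingle, cauchyIntegral, ← intervalIntegral.integral_const_mul]
  congr 1
  ext t
  rw [zpow_neg_one]
  ring

/-- Integration of a uniformly convergent unordered sum of continuous functions. -/
theorem hasSum_integral_of_tendstoUniformlyOn (h : IsPiecewiseLoop γ γ') {ι : Type*}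
    {G : ι → ℝ → ℂ} {g : ℝ → ℂ} (hG : ∀ l, ContinuousOn (G l) (Icc 0 1))
    (hg : TendstoUniformlyOn (fun (s : Finset ι) t => ∑ l ∈ s, G l t) g atTop (Icc 0 1)) :
    ContinuousOn g (Icc 0 1) ∧
      HasSum (fun l => ∫ t in (0 : ℝ)..1, G l t * γ' t) (∫ t in (0 : ℝ)..1, g t * γ' t) := by
  have hgc : ContinuousOn g (Icc 0 1) := hg.continuousOn
    (Frequently.of_forall fun s => continuousOn_finsetSum _ fun l _ => hG l)
  refine ⟨hgc, ?_⟩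
  set K := ∫ t in (0 : ℝ)..1, ‖γ' t‖ with hK
  have hK0 : 0 ≤ K := intervalIntegral.integral_nonneg zero_le_one fun t _ => norm_nonneg _
  rw [HasSum, SummationFilter.unconditional_filter, Metric.tendsto_nhds]
  intro ε hε
  have hδ : 0 < ε / (K + 1) := by positivity
  filter_upwards [Metric.tendstoUniformlyOn_iff.1 hg _ hδ] with s hs
  rw [← intervalIntegral.integral_finsetSum fun l _ => h.intervalIntegrable_mul (hG l),
    dist_comm, dist_eq_norm, ← intervalIntegral.integral_sub (h.intervalIntegrable_mul hgc)
      (by simpa only [Finset.sum_mul] using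
        h.intervalIntegrable_mul (continuousOn_finsetSum s fun l _ => hG l))]
  have hle : ‖∫ t in (0 : ℝ)..1, (g t * γ' t - ∑ l ∈ s, G l t * γ' t)‖ ≤
      ∫ t in (0 : ℝ)..1, ε / (K + 1) * ‖γ' t‖ := by
    refine intervalIntegral.norm_integral_le_of_norm_le zero_le_one
      (Eventually.of_forall fun t ht => ?_) (h.integrable.norm.const_mul _)
    rw [← Finset.sum_mul, ← sub_mul, norm_mul, ← dist_eq_norm]
    exact mul_le_mul_of_nonneg_right (hs t (Ioc_subset_Icc_self ht)).le (norm_nonneg _)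
  refine hle.trans_lt ?_
  rw [intervalIntegral.integral_const_mul, ← hK, div_mul_eq_mul_div, div_lt_iff₀ (by linarith)]
  nlinarith

end IsPiecewiseLoop

/-! ### Piecewise `C¹` paths -/

section PiecewiseC1

variable {E : Type*} [NormedAddCommGroup E] [NormedSpace ℝ E]

theorem exists_mem_Ioo_of_notMem_range {t : ℕ → ℝ} {N : ℕ} {x : ℝ} (h0 : t 0 < x) (hN : x < t N)
    (hx : x ∉ range t) : ∃ i < N, x ∈ Ioo (t i) (t (i + 1)) := by
  classical
  have hex : ∃ j, x < t j := ⟨N, hN⟩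
  have hpos : Nat.find hex ≠ 0 := fun h => (h ▸ Nat.find_spec hex).not_gt h0
  obtain ⟨i, hi⟩ := Nat.exists_eq_succ_of_ne_zero hpos
  have hle : t i ≤ x := not_lt.1 (Nat.find_min hex (by omega))
  have hleN : Nat.find hex ≤ N := Nat.find_min' hex hN
  refine ⟨i, by omega, lt_of_le_of_ne hle fun h => hx ⟨i, h⟩, ?_⟩
  have := Nat.find_spec hex
  rwa [hi] at this

theorem derivWithin_eq_deriv_of_mem_Ioo {g : ℝ → E} {a b x : ℝ} (hx : x ∈ Ioo a b) :
    derivWithin g (Icc a b) x = deriv g x :=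
  derivWithin_of_mem_nhds (Icc_mem_nhds hx.1 hx.2)

/-- On the closed piece its own one-sided derivative is continuous, hence integrable; it differs
from the derivative within `[0, 1]` at most at the two ends, a null set. -/
theorem intervalIntegrable_derivWithin_of_contDiffOn {g : ℝ → E} {a b : ℝ} (h0 : 0 ≤ a)
    (hab : a ≤ b) (h1 : b ≤ 1) (hg : ContDiffOn ℝ 1 g (Icc a b)) :
    IntervalIntegrable (derivWithin g (Icc 0 1)) volume a b := by
  rcases hab.eq_or_lt with rfl | hlt
  · simp
  have hc : ContinuousOn (derivWithin g (Icc a b)) (uIcc a b) := by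
    rw [uIcc_of_le hab]
    exact hg.continuousOn_derivWithin (uniqueDiffOn_Icc hlt) le_rfl
  have hi := hc.intervalIntegrable (μ := volume)
  rw [intervalIntegrable_iff_integrableOn_Ioo_of_le hab] at hi ⊢
  refine hi.congr_fun (fun x hx => ?_) measurableSet_Ioo
  rw [derivWithin_eq_deriv_of_mem_Ioo hx,
    derivWithin_eq_deriv_of_mem_Ioo ⟨h0.trans_lt hx.1, hx.2.trans_le h1⟩]

end PiecewiseC1

namespace PlanarComplex

variable {n : ℕ} {a : PlanarComplex n} {Γ : Path a a}

theorem IsPiecewiseC1.isPiecewiseLoop (hΓ : IsPiecewiseC1 Γ) (L : PlanarComplex n →L[ℝ] ℂ) :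
    IsPiecewiseLoop (fun t => L (Γ.extend t))
      (fun t => L (derivWithin Γ.extend (Icc 0 1) t)) := by
  obtain ⟨N, t, hmono, ht0, htN, hC⟩ := hΓ
  refine ⟨by simp, (L.continuous.comp Γ.continuous_extend).continuousOn, ?_,
    range t, countable_range t, ?_⟩
  · have hint : IntervalIntegrable (derivWithin Γ.extend (Icc 0 1)) volume (t 0) (t N) := by
      refine IntervalIntegrable.trans_iterate fun i hi => ?_
      refine intervalIntegrable_derivWithin_of_contDiffOn ?_ (hmono i.le_succ) ?_ (hC i hi)
      · exact ht0 ▸ hmono i.zero_le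
      · exact htN ▸ hmono hi
    rw [ht0, htN] at hint
    exact ⟨L.integrable_comp hint.1, L.integrable_comp hint.2⟩
  · rintro x ⟨hx, hxS⟩
    obtain ⟨i, hi, hxi⟩ := exists_mem_Ioo_of_notMem_range (ht0 ▸ hx.1) (htN ▸ hx.2) hxS
    have hd : ContDiffOn ℝ 1 Γ.extend (Ioo (t i) (t (i + 1))) := (hC i hi).mono Ioo_subset_Icc_self
    have hev : derivWithin Γ.extend (Icc 0 1) =ᶠ[𝓝 x] deriv Γ.extend := by
      filter_upwards [Ioo_mem_nhds hx.1 hx.2] with y hy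
      exact derivWithin_eq_deriv_of_mem_Ioo hy
    refine ⟨?_, L.continuous.continuousAt.comp ?_⟩
    · rw [hev.self_of_nhds]
      refine L.hasFDerivAt.comp_hasDerivAt x (DifferentiableAt.hasDerivAt ?_)
      exact (hd.differentiableOn one_ne_zero).differentiableAt (Ioo_mem_nhds hxi.1 hxi.2)
    · refine ContinuousAt.congr ?_ hev.symm
      exact (hd.continuousOn_deriv_of_isOpen isOpen_Ioo le_rfl).continuousAt
        (Ioo_mem_nhds hxi.1 hxi.2)

/-! ### The characters of the planar numbers -/

/-- The `n`-th roots of `-1`. -/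
noncomputable def rootNegOne (n k : ℕ) : ℂ :=
  Complex.exp (((Real.pi * (2 * (k : ℝ) - 1) / n : ℝ) : ℂ) * Complex.I)

theorem rootNegOne_pow (n k p : ℕ) : rootNegOne n k ^ p =
    Complex.exp (((Real.pi * (2 * (k : ℝ) - 1) * p / n : ℝ) : ℂ) * Complex.I) := by
  rw [rootNegOne, ← Complex.exp_nat_mul]
  congr 1
  push_cast
  ring

theorem rootNegOne_pow_self (hn : n ≠ 0) (k : ℕ) : rootNegOne n k ^ n = -1 := by
  have hn' : (n : ℝ) ≠ 0 := by exact_mod_cast hn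
  rw [rootNegOne_pow, mul_div_assoc, div_self hn', mul_one]
  have : ((Real.pi * (2 * (k : ℝ) - 1) : ℝ) : ℂ) * Complex.I =
      k * (2 * Real.pi * Complex.I) - Real.pi * Complex.I := by
    push_cast
    ring
  rw [this, Complex.exp_sub, Complex.exp_nat_mul, Complex.exp_two_pi_mul_I, Complex.exp_pi_mul_I]
  simp

theorem rootNegOne_ne_zero (n k : ℕ) : rootNegOne n k ≠ 0 := Complex.exp_ne_zero _

theorem rootNegOne_eq_iff (hn : n ≠ 0) {j k : ℕ} :
    rootNegOne n j = rootNegOne n k ↔ ∃ m : ℤ, (j : ℤ) = k + m * n := by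
  have hn' : (n : ℂ) ≠ 0 := by exact_mod_cast hn
  rw [rootNegOne, rootNegOne, Complex.exp_eq_exp_iff_exists_int]
  refine exists_congr fun m => ?_
  have hπ : (2 * Real.pi * Complex.I : ℂ) / n ≠ 0 := div_ne_zero Complex.two_pi_I_ne_zero hn'
  have : ((Real.pi * (2 * (j : ℝ) - 1) / n : ℝ) : ℂ) * Complex.I -
      (((Real.pi * (2 * (k : ℝ) - 1) / n : ℝ) : ℂ) * Complex.I + m * (2 * Real.pi * Complex.I)) =
      2 * Real.pi * Complex.I / n * ((j : ℂ) - (k + m * n)) := by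
    push_cast
    field_simp
    ring
  rw [← sub_eq_zero, this, mul_eq_zero, or_iff_right hπ, sub_eq_zero]
  exact_mod_cast Iff.rfl

/-- The two angles add up to `2π`. With `conj_rootNegOne`, this makes the characters of index above
`n/2` conjugate to those below. -/
theorem rootNegOne_reflect (hn : n ≠ 0) {j k : ℕ} (h : j + k = n + 1) :
    rootNegOne n j = (rootNegOne n k)⁻¹ := by
  have hn' : (n : ℂ) ≠ 0 := by exact_mod_cast hn
  have hj : (j : ℂ) = n + 1 - k := by rw [eq_sub_iff_add_eq]; exact_mod_cast h
  refine eq_inv_of_mul_eq_one_left ?_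
  rw [rootNegOne, rootNegOne, ← Complex.exp_add, ← Complex.exp_two_pi_mul_I]
  congr 1
  push_cast
  rw [hj]
  field_simp
  ring

theorem conj_rootNegOne (n k : ℕ) : starRingEnd ℂ (rootNegOne n k) = (rootNegOne n k)⁻¹ := by
  rw [rootNegOne, ← Complex.exp_conj, ← Complex.exp_neg, map_mul, Complex.conj_ofReal,
    Complex.conj_I, mul_neg]

/-- The linear form `u ↦ ∑ x_p ω_k ^ p`. -/
noncomputable def charLinear (n k : ℕ) : PlanarComplex n →ₗ[ℝ] ℂ where
  toFun u := ∑ p : Fin n, (u.coord p : ℂ) * rootNegOne n k ^ (p : ℕ)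
  map_add' u v := by simp [add_mul, Finset.sum_add_distrib]
  map_smul' r u := by simp [Finset.mul_sum, mul_assoc]

/-- The sign that the product picks up at each wrap-around of the index is exactly `ω_k ^ n = -1`;
this is what makes `charLinear` multiplicative. -/
theorem sum_structureConst_mul_pow (hn : n ≠ 0) (k b : ℕ) :
    ∑ q : Fin n, (structureConst n b q : ℂ) * rootNegOne n k ^ (q : ℕ) = rootNegOne n k ^ b := by
  rw [Finset.sum_eq_single (⟨b % n, Nat.mod_lt _ (Nat.pos_of_ne_zero hn)⟩ : Fin n)]
  · conv_rhs => rw [← Nat.div_add_mod b n, pow_add, pow_mul, rootNegOne_pow_self hn]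
    simp [structureConst]
  · intro q _ hq
    have : ¬ b % n = q := fun h => hq (Fin.ext h.symm)
    simp [structureConst, this]
  · simp

theorem charLinear_mul (hn : n ≠ 0) (k : ℕ) (u v : PlanarComplex n) :
    charLinear n k (u * v) = charLinear n k u * charLinear n k v := by
  change ∑ q : Fin n, ((u * v).coord q : ℂ) * rootNegOne n k ^ (q : ℕ) =
    (∑ p : Fin n, (u.coord p : ℂ) * rootNegOne n k ^ (p : ℕ)) *
      ∑ p : Fin n, (v.coord p : ℂ) * rootNegOne n k ^ (p : ℕ)
  rw [Finset.sum_mul_sum]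
  simp only [coord_mul, Complex.ofReal_sum, Complex.ofReal_mul, Finset.sum_mul]
  rw [Finset.sum_comm]
  refine Finset.sum_congr rfl fun i _ => ?_
  rw [Finset.sum_comm]
  refine Finset.sum_congr rfl fun j _ => ?_
  rw [mul_mul_mul_comm, ← pow_add, ← sum_structureConst_mul_pow hn k (i + j), Finset.mul_sum]
  exact Finset.sum_congr rfl fun q _ => by ring

theorem charLinear_one (hn : n ≠ 0) (k : ℕ) : charLinear n k 1 = 1 := by
  change ∑ q : Fin n, ((1 : PlanarComplex n).coord q : ℂ) * rootNegOne n k ^ (q : ℕ) = 1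
  rw [Finset.sum_eq_single (⟨0, Nat.pos_of_ne_zero hn⟩ : Fin n)]
  · simp [coord_one]
  · intro q _ hq
    have : ¬ (q : ℕ) = 0 := fun h => hq (Fin.ext h)
    simp [coord_one, this]
  · simp

/-- The algebra homomorphism that sends `h_p` to `ω_k ^ p`. -/
noncomputable def char (n k : ℕ) [NeZero n] : PlanarComplex n →ₐ[ℝ] ℂ :=
  AlgHom.ofLinearMap (charLinear n k) (charLinear_one (NeZero.ne n) k)
    (charLinear_mul (NeZero.ne n) k)

theorem sum_pow_eq_zero_of_pow_eq_one {ζ : ℂ} (h1 : ζ ^ n = 1) (hne : ζ ≠ 1) :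
    ∑ p : Fin n, ζ ^ (p : ℕ) = 0 := by
  rw [Fin.sum_univ_eq_sum_range fun p => ζ ^ p, geom_sum_eq hne, h1, sub_self, zero_div]

theorem extend_eq_of_mem (Γ : Path a a) {t : ℝ} (ht : t ∈ Icc (0 : ℝ) 1) :
    Γ.extend t = Γ ⟨t, ht⟩ := Path.extend_apply _ ht

variable [NeZero n]

theorem char_apply (k : ℕ) (u : PlanarComplex n) :
    char n k u = ∑ p : Fin n, (u.coord p : ℂ) * rootNegOne n k ^ (p : ℕ) := rfl

/-- `char` as a continuous linear map. -/
noncomputable def charL (n k : ℕ) [NeZero n] : PlanarComplex n →L[ℝ] ℂ :=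
  LinearMap.toContinuousLinearMap (char n k).toLinearMap

@[simp] theorem charL_apply (k : ℕ) (u : PlanarComplex n) : charL n k u = char n k u := rfl

theorem proj_eq (k : ℕ) (u : PlanarComplex n) :
    proj k u = (Real.sqrt (2 / n) : ℂ) * char n k u := by
  rw [char_apply, Finset.mul_sum]
  have hterm : ∀ p : Fin n,
      (Real.sqrt (2 / n) : ℂ) * ((u.coord p : ℂ) * rootNegOne n k ^ (p : ℕ)) =
      ((Real.sqrt (2 / n) * Real.cos (Real.pi * (2 * (k : ℝ) - 1) * (p : ℕ) / n) * u.coord p : ℝ)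
        : ℂ) + ((Real.sqrt (2 / n) * Real.sin (Real.pi * (2 * (k : ℝ) - 1) * (p : ℕ) / n) *
          u.coord p : ℝ) : ℂ) * Complex.I := by
    intro p
    rw [rootNegOne_pow, Complex.exp_mul_I, ← Complex.ofReal_cos, ← Complex.ofReal_sin]
    push_cast
    ring
  rw [Finset.sum_congr rfl fun p _ => hterm p, Finset.sum_add_distrib, ← Finset.sum_mul,
    ← Complex.ofReal_sum, ← Complex.ofReal_sum]
  exact (Complex.mk_eq_add_mul_I _ _)

theorem char_eq_zero_of_reflect {j k : ℕ} (h : j + k = n + 1) {u : PlanarComplex n}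
    (hu : char n k u = 0) : char n j u = 0 := by
  have : char n j u = starRingEnd ℂ (char n k u) := by
    simp only [char_apply, map_sum, map_mul, map_pow, conj_rootNegOne, Complex.conj_ofReal,
      rootNegOne_reflect (NeZero.ne n) h]
  rw [this, hu, map_zero]

/-- Conjugation extends the vanishing to all `n` roots of `-1`. These are distinct, so the
Vandermonde system for the components of `u` has only the zero solution. -/
theorem eq_zero_of_char_eq_zero (hn : Even n) {u : PlanarComplex n}
    (hu : ∀ k ∈ Finset.Icc 1 (n / 2), char n k u = 0) : u = 0 := by
  have hall : ∀ j : Fin n, char n (j + 1) u = 0 := by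
    intro j
    obtain ⟨m, hm⟩ := hn
    by_cases hj : (j : ℕ) + 1 ≤ n / 2
    · exact hu _ (Finset.mem_Icc.2 ⟨by omega, hj⟩)
    · exact char_eq_zero_of_reflect (k := n - j) (by omega)
        (hu _ (Finset.mem_Icc.2 ⟨by omega, by omega⟩))
  have hinj : Function.Injective fun j : Fin n => rootNegOne n ((j : ℕ) + 1) := by
    intro i j hij
    obtain ⟨m, hm⟩ := (rootNegOne_eq_iff (NeZero.ne n)).1 hij
    have hi := i.isLt
    have hj := j.isLt
    have hm0 : m = 0 := by
      push_cast at hm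
      have h1 : m * n < 1 * n := by linarith
      have h2 : (-1) * (n : ℤ) < m * n := by linarith
      have hn0 : (0 : ℤ) < n := by exact_mod_cast Nat.pos_of_ne_zero (NeZero.ne n)
      have := lt_of_mul_lt_mul_right h1 hn0.le
      have := lt_of_mul_lt_mul_right h2 hn0.le
      omega
    rw [hm0] at hm
    exact Fin.ext (by omega)
  have hv := Matrix.eq_zero_of_forall_index_sum_pow_mul_eq_zero hinj
    (v := fun p : Fin n => (u.coord p : ℂ)) fun j => by
      simpa only [char_apply, mul_comm] using hall j
  refine ext_coord fun p => ?_
  have := congrFun hv p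
  simpa using this

/-- Writing the sine through exponentials turns the value into `i/n` times the difference of the
geometric sums of `ω_j / ω_k` and `ω_j ω_k`, both `n`-th roots of unity. Since `2 ≤ j + k ≤ n`, the
product is never `1` and its sum vanishes; the quotient is `1` only for `j = k`, where its sum is
`n`. -/
theorem char_eTilde (hn : Even n) {j k : ℕ} (hj : j ∈ Finset.Icc 1 (n / 2))
    (hk : k ∈ Finset.Icc 1 (n / 2)) :
    char n j (eTilde n k) = if j = k then Complex.I else 0 := by
  have hn0 := NeZero.ne n
  have hnC : (n : ℂ) ≠ 0 := by exact_mod_cast hn0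
  rw [Finset.mem_Icc] at hj hk
  obtain ⟨m₀, hm₀⟩ := hn
  have hterm : ∀ p : Fin n, ((eTilde n k).coord p : ℂ) * rootNegOne n j ^ (p : ℕ) =
      Complex.I / n * ((rootNegOne n j * (rootNegOne n k)⁻¹) ^ (p : ℕ) -
        (rootNegOne n j * rootNegOne n k) ^ (p : ℕ)) := by
    intro p
    rw [eTilde, coord_ofCoord, Complex.ofReal_mul, Complex.ofReal_sin, Complex.sin, neg_mul,
      Complex.exp_neg, ← rootNegOne_pow, mul_pow, mul_pow, inv_pow]
    push_cast
    ring
  have hprod : ∑ p : Fin n, (rootNegOne n j * rootNegOne n k) ^ (p : ℕ) = 0 := by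
    refine sum_pow_eq_zero_of_pow_eq_one ?_ fun h => ?_
    · rw [mul_pow, rootNegOne_pow_self hn0, rootNegOne_pow_self hn0]
      norm_num
    · have hr : rootNegOne n j = rootNegOne n (n + 1 - k) := by
        rw [rootNegOne_reflect hn0 (j := n + 1 - k) (k := k) (by omega)]
        exact eq_inv_of_mul_eq_one_left h
      obtain ⟨m, hm⟩ := (rootNegOne_eq_iff hn0).1 hr
      rw [Nat.cast_sub (by omega)] at hm
      push_cast at hm
      have h1 : m * n < 0 * n := by omega
      have h2 : (-1) * (n : ℤ) < m * n := by omega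
      have hn1 : (0 : ℤ) ≤ n := by positivity
      have := lt_of_mul_lt_mul_right h1 hn1
      have := lt_of_mul_lt_mul_right h2 hn1
      omega
  rw [char_apply, Finset.sum_congr rfl fun p _ => hterm p, ← Finset.mul_sum,
    Finset.sum_sub_distrib, hprod, sub_zero]
  split_ifs with hjk
  · subst hjk
    simp [mul_inv_cancel₀ (rootNegOne_ne_zero n j), hnC]
  · rw [sum_pow_eq_zero_of_pow_eq_one, mul_zero]
    · rw [mul_pow, inv_pow, rootNegOne_pow_self hn0, rootNegOne_pow_self hn0]
      norm_num
    · intro h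
      obtain ⟨m, hm⟩ := (rootNegOne_eq_iff hn0).1
        ((mul_inv_eq_one₀ (rootNegOne_ne_zero n k)).1 h)
      have h1 : m * n < 1 * n := by omega
      have h2 : (-1) * (n : ℤ) < m * n := by omega
      have hn1 : (0 : ℤ) ≤ n := by positivity
      have := lt_of_mul_lt_mul_right h1 hn1
      have := lt_of_mul_lt_mul_right h2 hn1
      obtain rfl : m = 0 := by omega
      omega

/-- The characters determine a planar number continuously. -/
theorem exists_leftInverse_char (hn : Even n) :
    ∃ g : (Finset.Icc 1 (n / 2) → ℂ) →L[ℝ] PlanarComplex n,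
      ∀ u, g (fun k => char n k u) = u := by
  let f : PlanarComplex n →ₗ[ℝ] (Finset.Icc 1 (n / 2) → ℂ) :=
    LinearMap.pi fun k => (char n k).toLinearMap
  have hf : LinearMap.ker f = ⊥ := LinearMap.ker_eq_bot'.2 fun u hu =>
    eq_zero_of_char_eq_zero hn fun k hk => congrFun hu ⟨k, hk⟩
  obtain ⟨g, hg⟩ := f.exists_leftInverse_of_injective hf
  exact ⟨LinearMap.toContinuousLinearMap g, fun u => LinearMap.congr_fun hg u⟩

theorem eq_of_char_eq (hn : Even n) {u v : PlanarComplex n}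
    (h : ∀ k ∈ Finset.Icc 1 (n / 2), char n k u = char n k v) : u = v :=
  sub_eq_zero.1 (eq_zero_of_char_eq_zero hn fun k hk => by rw [map_sub, h k hk, sub_self])

theorem hasSum_of_char (hn : Even n) {ι : Type*} {r : ι → PlanarComplex n} {s : PlanarComplex n}
    (h : ∀ k ∈ Finset.Icc 1 (n / 2), HasSum (fun l => char n k (r l)) (char n k s)) :
    HasSum r s := by
  obtain ⟨g, hg⟩ := exists_leftInverse_char hn
  have hpi : HasSum (fun l (k : Finset.Icc 1 (n / 2)) => char n k (r l))
      (fun k : Finset.Icc 1 (n / 2) => char n k s) := Pi.hasSum.2 fun k => h k k.2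
  simpa only [hg] using! hpi.mapL g

theorem intervalIntegrable_of_char (hn : Even n) {v : ℝ → PlanarComplex n}
    (h : ∀ k ∈ Finset.Icc 1 (n / 2), IntervalIntegrable (fun t => char n k (v t)) volume 0 1) :
    IntervalIntegrable v volume 0 1 := by
  obtain ⟨g, hg⟩ := exists_leftInverse_char hn
  have h1 := g.integrable_comp (Integrable.of_eval fun k : Finset.Icc 1 (n / 2) => (h k k.2).1)
  have h2 := g.integrable_comp (Integrable.of_eval fun k : Finset.Icc 1 (n / 2) => (h k k.2).2)
  simp only [hg] at h1 h2
  exact ⟨h1, h2⟩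

/-! ### Loop integrals computed in the characters -/

theorem char_curveIntegralFun (k : ℕ) (f : PlanarComplex n → PlanarComplex n) (t : ℝ) :
    char n k (curveIntegralFun (form f) Γ t) = char n k (f (Γ.extend t)) *
      charL n k (derivWithin Γ.extend (Icc 0 1) t) := by
  rw [curveIntegralFun_def, charL_apply, ← map_mul]
  rfl

theorem curveIntegrable_of_char (hn : Even n) (hΓ : IsPiecewiseC1 Γ)
    {f : PlanarComplex n → PlanarComplex n}
    (h : ∀ k ∈ Finset.Icc 1 (n / 2),
      ContinuousOn (fun t => char n k (f (Γ.extend t))) (Icc 0 1)) :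
    CurveIntegrable (form f) Γ :=
  intervalIntegrable_of_char hn fun k hk => by
    simpa only [char_curveIntegralFun] using
      (hΓ.isPiecewiseLoop (charL n k)).intervalIntegrable_mul (h k hk)

theorem char_curveIntegral {f : PlanarComplex n → PlanarComplex n}
    (h : CurveIntegrable (form f) Γ) (k : ℕ) :
    char n k (curveIntegral (form f) Γ) = ∫ t in (0 : ℝ)..1, char n k (f (Γ.extend t)) *
      charL n k (derivWithin Γ.extend (Icc 0 1) t) := by
  have := (charL n k).intervalIntegral_comp_comm h
  rw [curveIntegral_def, ← charL_apply, ← this]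
  simp only [charL_apply, char_curveIntegralFun]

theorem char_inverse (k : ℕ) {w : PlanarComplex n} (hw : IsUnit w) :
    char n k (Ring.inverse w) = (char n k w)⁻¹ :=
  eq_inv_of_mul_eq_one_left (by rw [← map_mul, Ring.inverse_mul_cancel w hw, map_one])

theorem char_intPow (k : ℕ) {w : PlanarComplex n} (hw : IsUnit w) (m : ℤ) :
    char n k (intPow w m) = char n k w ^ m := by
  cases m with
  | ofNat m => simp [intPow]
  | negSucc m => simp [intPow, char_inverse k hw, zpow_negSucc]

theorem char_ne_of_isUnit_sub (k : ℕ) {u v : PlanarComplex n} (h : IsUnit (u - v)) :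
    char n k u ≠ char n k v := by
  have := (h.map (char n k)).ne_zero
  rwa [map_sub, sub_ne_zero] at this

/-- Orientation and interior refer to the projected curve, which is the character multiplied by
`√(2/n)`; `dw / (w - z)` does not change when `w` and `z` are scaled together. -/
theorem cauchyIntegral_char (hΓ : IsPiecewiseC1 Γ) {k : ℕ}
    (hor : IsCounterclockwise (projLoop k Γ)) {u₀ : PlanarComplex n}
    (hu : ∀ t, IsUnit (Γ t - u₀)) :
    cauchyIntegral (fun t => charL n k (Γ.extend t))
      (fun t => charL n k (derivWithin Γ.extend (Icc 0 1) t)) (char n k u₀) =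
      2 * Real.pi * Complex.I * intProj k u₀ Γ := by
  set s : ℂ := (Real.sqrt (2 / n) : ℂ) with hs
  have hs0 : s ≠ 0 := by
    have hn0 : (0 : ℝ) < n := by exact_mod_cast Nat.pos_of_ne_zero (NeZero.ne n)
    exact Complex.ofReal_ne_zero.2 (Real.sqrt_pos.2 (by positivity)).ne'
  have hloop := hΓ.isPiecewiseLoop (s • charL n k)
  have hcurve : (fun t : unitInterval => (s • charL n k) (Γ.extend t)) = projLoop k Γ := by
    ext t
    simp [projLoop, proj_eq, hs]
  have hne : ∀ t ∈ Icc (0 : ℝ) 1, (s • charL n k) (Γ.extend t) ≠ proj k u₀ := by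
    intro t ht he
    rw [proj_eq, extend_eq_of_mem Γ ht] at he
    exact char_ne_of_isUnit_sub k (hu ⟨t, ht⟩) (mul_left_cancel₀ hs0 he)
  have key := hloop.cauchyIntegral_eq_interiorIndicator (by rwa [hcurve]) hne
  rw [hcurve] at key
  rw [intProj, ← key, cauchyIntegral, cauchyIntegral]
  congr 1
  ext t
  rw [proj_eq, ← hs]
  simp only [smul_apply, smul_eq_mul, ← mul_sub]
  rw [mul_div_mul_left _ _ hs0]

/-- Only the summand `ẽ_k` survives in the `k`-th character, and its value `i` turns `2π` into the
factor `2πi` of the complex residue theorem. -/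
theorem char_residue (hn : Even n) {k : ℕ} (hk : k ∈ Finset.Icc 1 (n / 2)) (u₀ : PlanarComplex n)
    (r : PlanarComplex n) :
    char n k ((2 * Real.pi) • ((∑ k ∈ Finset.Icc 1 (n / 2), intProj k u₀ Γ • eTilde n k) * r)) =
      char n k r * (2 * Real.pi * Complex.I * intProj k u₀ Γ) := by
  rw [map_smul, map_mul, map_sum, Finset.sum_eq_single_of_mem k hk]
  · rw [map_smul, char_eTilde hn hk hk, if_pos rfl, Complex.real_smul, Complex.real_smul]
    push_cast
    ring
  · intro j hj hjk
    rw [map_smul, char_eTilde hn hk hj, if_neg (Ne.symm hjk), smul_zero]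

/-- Integration of a series in integer powers of `u - u₀`, with convergence expressed through the
characters. -/
theorem char_integral_laurent (hΓ : IsPiecewiseC1 Γ) {k : ℕ}
    (hor : IsCounterclockwise (projLoop k Γ)) {u₀ : PlanarComplex n}
    (hu : ∀ t, IsUnit (Γ t - u₀)) {F : PlanarComplex n → PlanarComplex n}
    {b : ℤ → PlanarComplex n}
    (hF : ∀ t, HasSum (fun m : ℤ => char n k (b m) * char n k (Γ t - u₀) ^ m)
      (char n k (F (Γ t)))) :
    ContinuousOn (fun t => char n k (F (Γ.extend t))) (Icc 0 1) ∧
      ∫ t in (0 : ℝ)..1, char n k (F (Γ.extend t)) *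
        charL n k (derivWithin Γ.extend (Icc 0 1) t) =
      char n k (b (-1)) * (2 * Real.pi * Complex.I * intProj k u₀ Γ) := by
  rw [← cauchyIntegral_char hΓ hor hu]
  refine (hΓ.isPiecewiseLoop (charL n k)).integral_laurent (b := fun m => char n k (b m))
    (G := fun t => char n k (F (Γ.extend t))) (fun t ht => ?_) fun t ht => ?_
  · rw [extend_eq_of_mem Γ ht]
    exact char_ne_of_isUnit_sub k (hu _)
  · rw [extend_eq_of_mem Γ ht]
    simpa only [map_sub, charL_apply] using hF ⟨t, ht⟩

/-- Convergence is required only of the complex series in the characters, so that closed expressions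
such as `Ring.inverse (u - u₀)` can be inserted directly. -/
theorem hasLoopIntegral_laurent (hn : Even n) (hΓ : IsPiecewiseC1 Γ)
    (hor : ∀ k ∈ Finset.Icc 1 (n / 2), IsCounterclockwise (projLoop k Γ)) {u₀ : PlanarComplex n}
    (hu : ∀ t, IsUnit (Γ t - u₀)) {F : PlanarComplex n → PlanarComplex n}
    {b : ℤ → PlanarComplex n}
    (hF : ∀ k ∈ Finset.Icc 1 (n / 2), ∀ t,
      HasSum (fun m : ℤ => char n k (b m) * char n k (Γ t - u₀) ^ m) (char n k (F (Γ t)))) :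
    HasLoopIntegral F Γ
      ((2 * Real.pi) • ((∑ k ∈ Finset.Icc 1 (n / 2), intProj k u₀ Γ • eTilde n k) * b (-1))) := by
  have hint : CurveIntegrable (form F) Γ := curveIntegrable_of_char hn hΓ fun k hk =>
    (char_integral_laurent hΓ (hor k hk) hu (hF k hk)).1
  refine ⟨hint, eq_of_char_eq hn fun k hk => ?_⟩
  rw [char_curveIntegral hint, char_residue hn hk,
    (char_integral_laurent hΓ (hor k hk) hu (hF k hk)).2]

theorem hasLoopIntegral_inverse (hn : Even n) (hΓ : IsPiecewiseC1 Γ)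
    (hor : ∀ k ∈ Finset.Icc 1 (n / 2), IsCounterclockwise (projLoop k Γ)) {u₀ : PlanarComplex n}
    (hu : ∀ t, IsUnit (Γ t - u₀)) :
    HasLoopIntegral (fun u => Ring.inverse (u - u₀)) Γ
      (∑ k ∈ Finset.Icc 1 (n / 2), (2 * Real.pi * intProj k u₀ Γ) • eTilde n k) := by
  -- The inverse is the Laurent series whose only coefficient is `1`, at exponent `-1`.
  have h := hasLoopIntegral_laurent hn hΓ hor hu (F := fun u => Ring.inverse (u - u₀))
    (b := Pi.single (-1) 1) fun k _ t => by
      rw [char_inverse k (hu t)]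
      convert hasSum_single (-1 : ℤ) (f := fun m : ℤ =>
        char n k ((Pi.single (-1) 1 : ℤ → PlanarComplex n) m) * char n k (Γ t - u₀) ^ m)
        (fun m hm => by rw [Pi.single_eq_of_ne hm, map_zero, zero_mul]) using 1
      simp
  simpa only [Pi.single_eq_same, mul_one, Finset.smul_sum, smul_smul] using h

theorem hasLoopIntegral_powerSeries_mul_inverse (hn : Even n) (hΓ : IsPiecewiseC1 Γ)
    (hor : ∀ k ∈ Finset.Icc 1 (n / 2), IsCounterclockwise (projLoop k Γ)) {u₀ : PlanarComplex n}
    (hu : ∀ t, IsUnit (Γ t - u₀)) {f : PlanarComplex n → PlanarComplex n}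
    {c : ℕ → PlanarComplex n}
    (hf : ∀ u ∈ insert u₀ (range Γ), HasSum (fun m => c m * (u - u₀) ^ m) (f u)) :
    HasLoopIntegral (fun u => f u * Ring.inverse (u - u₀)) Γ
      ((2 * Real.pi) • (f u₀ * ∑ k ∈ Finset.Icc 1 (n / 2), intProj k u₀ Γ • eTilde n k)) := by
  -- Here the expansion at `u₀` itself is used: all terms with `m ≠ 0` vanish there.
  have hc0 : f u₀ = c 0 := by
    refine (hf u₀ (mem_insert _ _)).unique ?_
    convert hasSum_single 0 (f := fun m => c m * (u₀ - u₀) ^ m)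
      (fun m hm => by rw [sub_self, zero_pow hm, mul_zero]) using 1
    simp
  -- Division by `u - u₀` lowers each exponent by one, so `c (m + 1)` stands at exponent `m`,
  -- nothing below `-1`, and the residue is `c 0`.
  let b : ℤ → PlanarComplex n := fun m => if -1 ≤ m then c (m + 1).toNat else 0
  have h := hasLoopIntegral_laurent hn hΓ hor hu
    (F := fun u => f u * Ring.inverse (u - u₀)) (b := b) fun k _ t => by
      have hinj : Function.Injective fun m : ℕ => (m : ℤ) - 1 := fun i j hij => by
        simpa using hij
      rw [← hinj.hasSum_iff]
      · have hne : char n k (Γ t - u₀) ≠ 0 := ((hu t).map (char n k)).ne_zero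
        have h1 := ((charL n k).hasSum (hf (Γ t) (mem_insert_of_mem _ ⟨t, rfl⟩))).mul_right
          (char n k (Γ t - u₀))⁻¹
        rw [map_mul, char_inverse k (hu t)]
        convert! h1 using 1
        ext m
        have hle : -1 ≤ (m : ℤ) - 1 := by omega
        simp only [Function.comp_apply, b, if_pos hle, sub_add_cancel, Int.toNat_natCast,
          charL_apply, map_mul, map_pow, zpow_sub₀ hne, zpow_natCast, zpow_one, div_eq_mul_inv,
          mul_assoc]
      · intro m hm
        have hlt : ¬ -1 ≤ m := fun hle => hm ⟨(m + 1).toNat, by simp; omega⟩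
        simp [b, hlt]
  have hb : b (-1) = c 0 := by simp [b]
  rwa [hb, ← hc0, mul_comm _ (f u₀)] at h

/-- A character is linear and uniformly continuous, so it preserves the uniform convergence of the
partial sums; the integrals of the `F l` then sum to that of `f` in each character, and hence in the
algebra. -/
theorem hasLoopIntegral_sum_laurent (hn : Even n) (hΓ : IsPiecewiseC1 Γ)
    (hor : ∀ k ∈ Finset.Icc 1 (n / 2), IsCounterclockwise (projLoop k Γ)) {ι : Type*}
    {p : ι → PlanarComplex n} {c : ι → ℤ → PlanarComplex n}
    {F : ι → PlanarComplex n → PlanarComplex n} {f : PlanarComplex n → PlanarComplex n}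
    (hu : ∀ l t, IsUnit (Γ t - p l))
    (hF : ∀ l, ∀ u ∈ range Γ, HasSum (fun m : ℤ => c l m * intPow (u - p l) m) (F l u))
    (hf : TendstoUniformlyOn (fun (s : Finset ι) u => ∑ l ∈ s, F l u) f atTop (range Γ)) :
    ∃ I : PlanarComplex n, HasLoopIntegral f Γ I ∧
      HasSum (fun l => (2 * Real.pi) • ((∑ k ∈ Finset.Icc 1 (n / 2),
        intProj k (p l) Γ • eTilde n k) * c l (-1))) I := by
  have hterm : ∀ k ∈ Finset.Icc 1 (n / 2), ∀ l,
      ContinuousOn (fun t => char n k (F l (Γ.extend t))) (Icc 0 1) ∧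
        ∫ t in (0 : ℝ)..1, char n k (F l (Γ.extend t)) *
          charL n k (derivWithin Γ.extend (Icc 0 1) t) =
        char n k (c l (-1)) * (2 * Real.pi * Complex.I * intProj k (p l) Γ) := by
    intro k hk l
    refine char_integral_laurent hΓ (hor k hk) (hu l) fun t => ?_
    have h1 := (charL n k).hasSum (hF l (Γ t) ⟨t, rfl⟩)
    simpa only [charL_apply, map_mul, char_intPow k (hu l t)] using! h1
  have hunif : ∀ k, TendstoUniformlyOn
      (fun (s : Finset ι) t => ∑ l ∈ s, char n k (F l (Γ.extend t)))
      (fun t => char n k (f (Γ.extend t))) atTop (Icc 0 1) := by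
    intro k
    have h1 := ((charL n k).uniformContinuous.comp_tendstoUniformlyOn hf).comp Γ.extend
    have h2 : Icc (0 : ℝ) 1 ⊆ Γ.extend ⁻¹' range Γ := fun t ht =>
      ⟨⟨t, ht⟩, (extend_eq_of_mem Γ ht).symm⟩
    refine (h1.mono h2).congr (Eventually.of_forall fun s t _ => ?_)
    exact map_sum (charL n k) (fun l => F l (Γ.extend t)) s
  have hsum : ∀ k ∈ Finset.Icc 1 (n / 2), _ := fun k hk =>
    (hΓ.isPiecewiseLoop (charL n k)).hasSum_integral_of_tendstoUniformlyOn
      (fun l => (hterm k hk l).1) (hunif k)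
  have hint : CurveIntegrable (form f) Γ := curveIntegrable_of_char hn hΓ fun k hk => (hsum k hk).1
  refine ⟨_, ⟨hint, rfl⟩, hasSum_of_char hn fun k hk => ?_⟩
  rw [char_curveIntegral hint]
  simp only [char_residue hn hk]
  convert! (hsum k hk).2 using 1
  ext l
  exact (hterm k hk l).2.symm

end PlanarComplex

end

/-! ### The three integral formulas -/

theorem mainTheorem3 (n : ℕ) (hn : Even n) (hpos : 0 < n)
    {a : PlanarComplex n} (Γ : Path a a) (hΓ : PlanarComplex.IsPiecewiseC1 Γ)
    (hor : ∀ k ∈ Finset.Icc 1 (n / 2),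
      PlanarComplex.IsCounterclockwise (PlanarComplex.projLoop k Γ)) :
    (∀ u₀ : PlanarComplex n, (∀ t, IsUnit (Γ t - u₀)) →
      PlanarComplex.HasLoopIntegral (fun u => Ring.inverse (u - u₀)) Γ
        (∑ k ∈ Finset.Icc 1 (n / 2),
          (2 * Real.pi * PlanarComplex.intProj k u₀ Γ) • PlanarComplex.eTilde n k)) ∧
    (∀ (u₀ : PlanarComplex n) (f : PlanarComplex n → PlanarComplex n) (c : ℕ → PlanarComplex n),
      (∀ t, IsUnit (Γ t - u₀)) →
      (∀ u ∈ insert u₀ (Set.range Γ), HasSum (fun m => c m * (u - u₀) ^ m) (f u)) →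
      PlanarComplex.HasLoopIntegral (fun u => f u * Ring.inverse (u - u₀)) Γ
        ((2 * Real.pi) • (f u₀ * ∑ k ∈ Finset.Icc 1 (n / 2),
          PlanarComplex.intProj k u₀ Γ • PlanarComplex.eTilde n k))) ∧
    (∀ (ι : Type*) (p : ι → PlanarComplex n) (c : ι → ℤ → PlanarComplex n)
      (F : ι → PlanarComplex n → PlanarComplex n) (f : PlanarComplex n → PlanarComplex n),
      (∀ l t, IsUnit (Γ t - p l)) →
      (∀ l, ∀ u ∈ Set.range Γ,
        HasSum (fun m : ℤ => c l m * PlanarComplex.intPow (u - p l) m) (F l u)) →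
      TendstoUniformlyOn (fun (s : Finset ι) u => ∑ l ∈ s, F l u) f Filter.atTop (Set.range Γ) →
      ∃ I : PlanarComplex n, PlanarComplex.HasLoopIntegral f Γ I ∧
        HasSum (fun l => (2 * Real.pi) • ((∑ k ∈ Finset.Icc 1 (n / 2),
          PlanarComplex.intProj k (p l) Γ • PlanarComplex.eTilde n k) * c l (-1))) I) := by
  have : NeZero n := ⟨hpos.ne'⟩
  refine ⟨fun u₀ hu => PlanarComplex.hasLoopIntegral_inverse hn hΓ hor hu, ?_, ?_⟩
  · intro u₀ f c hu hf
    exact PlanarComplex.hasLoopIntegral_powerSeries_mul_inverse hn hΓ hor hu hf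
  · intro ι p c F f hu hF hf
    exact PlanarComplex.hasLoopIntegral_sum_laurent hn hΓ hor hu hF hf
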